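/- Let $G$ be a locally compact abelian group with dual group $\widehat G$ of continuous characters $\chi:G\to\{z\in\mathbb C:|z|=1\}$. For $f\in L^1(G)$ let $\hat f(\chi)=\int_G\overline{\chi(x)}f(x)\,dm(x)$ be its Fourier transform, where $m$ is a fixed Haar measure on $G$. Call a function $f$ on $G$ *good* if 1. $f$ is real-valued, nonnegative, continuous and positive-definite, i.e. $\sum_{i,j=1}^{k}c_i\overline{c_j}f(x_i-x_j)\ge 0$ for all $k$, all $x_1,\dots,x_k\in G$ and all $c_1,\dots,c_k\in\mathbb C$; 2. $f\in L^1(G)$; 3. $\hat f$ is continuous and belongs to $L^1(\widehat G)$; 4. $f$ and $\hat f$ are strictly positive everywhere; 5. for all closed subgroups $H\subseteq G$ and $K\subseteq\widehat G$, the restrictions $f|_H$ and $\hat f|_K$ are integrable with respect to the Haar measures on $H$ and $K$. (These conditions do not depend on the choice of Haar measures.) The good functions on $G$ form a convex cone in the real vector space of functions $G\to\mathbb R$. **Theorem 5.2.** Let $Q$ be a positive-definite quadratic form on $\mathbb R^n$. Then the function $f(x)=e^{-Q(x)}$ on $G=\mathbb R^n$ is good, and it generates an extremal ray of the cone of good functions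 on $\mathbb R^n$: if $g$ and $h$ are good functions on $\mathbb R^n$ with $g+h=f$, then $g=sf$ and $h=tf$ for some real $s,t\ge 0$. -/

import Mathlib

open MeasureTheory
open scoped ComplexOrder ComplexConjugate

noncomputable section

/-- The character group of a locally compact abelian group carries its Borel σ-algebra. -/
instance PontryaginDual.instMeasurableSpaceBorel (A : Type*) [Monoid A] [TopologicalSpace A] :
    MeasurableSpace (PontryaginDual A) := borel _

instance PontryaginDual.instBorelSpaceBorel (A : Type*) [Monoid A] [TopologicalSpace A] :
    BorelSpace (PontryaginDual A) := ⟨rfl⟩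

namespace GoodFunctions

section Group

variable {G : Type*} [AddCommGroup G] [TopologicalSpace G]

variable (G) in
/-- The Pontryagin dual `Ĝ` of an additively written group `G`: continuous characters
`G → Circle`, with pointwise multiplication and the compact-open topology. -/
abbrev Dual : Type _ := PontryaginDual (Multiplicative G)

/-- `f` is positive-definite: `∑ᵢⱼ cᵢ c̄ⱼ f(xᵢ - xⱼ) ≥ 0` for all finite families
(`0 ≤ z` in `ℂ` means that `z` is real and nonnegative). -/
def IsPositiveDefinite (f : G → ℂ) : Prop :=
  ∀ (n : ℕ) (x : Fin n → G) (c : Fin n → ℂ),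
    0 ≤ ∑ i, ∑ j, c i * conj (c j) * f (x i - x j)

/-- Positive positive-definite (PPD) functions: real-valued, nonnegative, continuous and
positive-definite. -/
structure IsPPD (f : G → ℝ) : Prop where
  nonneg : ∀ x, 0 ≤ f x
  continuous : Continuous f
  positiveDefinite : IsPositiveDefinite (fun x => (f x : ℂ))

theorem IsPPD.add {f g : G → ℝ} (hf : IsPPD f) (hg : IsPPD g) : IsPPD (f + g) where
  nonneg x := add_nonneg (hf.nonneg x) (hg.nonneg x)
  continuous := hf.continuous.add hg.continuous
  positiveDefinite n x c := by
    have h := add_nonneg (hf.positiveDefinite n x c) (hg.positiveDefinite n x c)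
    simpa only [Pi.add_apply, Complex.ofReal_add, mul_add, Finset.sum_add_distrib] using h

theorem IsPPD.smul {f : G → ℝ} (hf : IsPPD f) {a : ℝ} (ha : 0 ≤ a) : IsPPD (a • f) where
  nonneg x := mul_nonneg ha (hf.nonneg x)
  continuous := hf.continuous.const_smul a
  positiveDefinite n x c := by
    have h := mul_nonneg (Complex.zero_le_real.2 ha) (hf.positiveDefinite n x c)
    simpa only [Pi.smul_apply, smul_eq_mul, Complex.ofReal_mul, Finset.mul_sum,
      mul_left_comm] using h

variable [IsTopologicalAddGroup G] [LocallyCompactSpace G] [MeasurableSpace G] [BorelSpace G]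

/-- The Fourier transform `f̂(χ) = ∫ conj(χ(x)) f(x) dm(x)` on `Ĝ`, for a fixed Haar measure `m`
of `G`. Another Haar measure changes it by a positive factor only. -/
def fourierTransform (f : G → ℝ) (χ : Dual G) : ℂ :=
  ∫ x, conj (χ (Multiplicative.ofAdd x) : ℂ) * (f x : ℂ) ∂(Measure.addHaar : Measure G)

/-- Good functions on a locally compact abelian group `G`. None of the conditions depends on the
normalization of the Haar measures. (`0 < z` in `ℂ` means that `z` is real and positive.) -/
structure IsGood (f : G → ℝ) : Prop where
  ppd : IsPPD f
  integrable : Integrable f (Measure.addHaar : Measure G)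
  continuous_fourierTransform : Continuous (fourierTransform f)
  integrable_fourierTransform : Integrable (fourierTransform f) (Measure.haar : Measure (Dual G))
  pos : ∀ x, 0 < f x
  fourierTransform_pos : ∀ χ, 0 < fourierTransform f χ
  integrable_subgroup : ∀ H : AddSubgroup G, IsClosed (H : Set G) →
    ∀ μ : Measure H, μ.IsAddHaarMeasure → μ.Regular → Integrable (fun x : H => f x) μ
  integrable_fourierTransform_subgroup : ∀ H : Subgroup (Dual G), IsClosed (H : Set (Dual G)) →
    ∀ μ : Measure H, μ.IsHaarMeasure → μ.Regular → Integrable (fun χ : H => fourierTransform f χ) μ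

theorem fourierTransform_smul (a : ℝ) (f : G → ℝ) : fourierTransform (a • f) = (a : ℂ) • fourierTransform f := by
  funext χ
  simp only [fourierTransform, Pi.smul_apply, smul_eq_mul, Complex.ofReal_mul, mul_left_comm _ (a : ℂ)]
  exact integral_const_mul _ _

theorem integrable_conj_mul {f : G → ℝ} (hf : Integrable f (Measure.addHaar : Measure G))
    (χ : Dual G) :
    Integrable (fun x => conj (χ (Multiplicative.ofAdd x) : ℂ) * (f x : ℂ))
      (Measure.addHaar : Measure G) := by
  have hχ : Continuous fun x : G => conj (χ (Multiplicative.ofAdd x) : ℂ) :=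
    Complex.continuous_conj.comp
      (continuous_subtype_val.comp ((map_continuous χ).comp continuous_ofAdd))
  refine hf.ofReal.bdd_mul (c := 1) hχ.measurable.aestronglyMeasurable ?_
  exact Filter.Eventually.of_forall fun x => by
    rw [RCLike.norm_conj]
    exact (Circle.norm_coe _).le

theorem fourierTransform_add {f g : G → ℝ} (hf : Integrable f (Measure.addHaar : Measure G))
    (hg : Integrable g (Measure.addHaar : Measure G)) :
    fourierTransform (f + g) = fourierTransform f + fourierTransform g := by
  funext χ
  simp only [fourierTransform, Pi.add_apply, Complex.ofReal_add, mul_add]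
  exact integral_add (integrable_conj_mul hf χ) (integrable_conj_mul hg χ)

variable (G) in
/-- The convex cone of good functions, in the real vector space of all functions `G → ℝ`. -/
def goodCone : ConvexCone ℝ (G → ℝ) where
  carrier := {f | IsGood f}
  smul_mem' a ha f hf :=
    { ppd := hf.ppd.smul ha.le
      integrable := hf.integrable.smul a
      continuous_fourierTransform := by
        rw [fourierTransform_smul]; exact hf.continuous_fourierTransform.const_smul (a : ℂ)
      integrable_fourierTransform := by
        rw [fourierTransform_smul]; exact hf.integrable_fourierTransform.smul (a : ℂ)
      pos := fun x => mul_pos ha (hf.pos x)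
      fourierTransform_pos := fun χ => by
        rw [fourierTransform_smul]; exact mul_pos (Complex.zero_lt_real.2 ha) (hf.fourierTransform_pos χ)
      integrable_subgroup := fun H hH μ h1 h2 => (hf.integrable_subgroup H hH μ h1 h2).smul a
      integrable_fourierTransform_subgroup := fun H hH μ h1 h2 => by
        rw [fourierTransform_smul]
        exact (hf.integrable_fourierTransform_subgroup H hH μ h1 h2).smul (a : ℂ) }
  add_mem' f hf g hg :=
    { ppd := hf.ppd.add hg.ppd
      integrable := hf.integrable.add hg.integrable
      continuous_fourierTransform := by
        rw [fourierTransform_add hf.integrable hg.integrable]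
        exact hf.continuous_fourierTransform.add hg.continuous_fourierTransform
      integrable_fourierTransform := by
        rw [fourierTransform_add hf.integrable hg.integrable]
        exact hf.integrable_fourierTransform.add hg.integrable_fourierTransform
      pos := fun x => add_pos (hf.pos x) (hg.pos x)
      fourierTransform_pos := fun χ => by
        rw [fourierTransform_add hf.integrable hg.integrable]
        exact add_pos (hf.fourierTransform_pos χ) (hg.fourierTransform_pos χ)
      integrable_subgroup := fun H hH μ h1 h2 =>
        (hf.integrable_subgroup H hH μ h1 h2).add (hg.integrable_subgroup H hH μ h1 h2)
      integrable_fourierTransform_subgroup := fun H hH μ h1 h2 => by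
        rw [fourierTransform_add hf.integrable hg.integrable]
        exact (hf.integrable_fourierTransform_subgroup H hH μ h1 h2).add
          (hg.integrable_fourierTransform_subgroup H hH μ h1 h2) }

end Group

/-- `f` generates an extremal ray of the convex cone `C`: `f` is a nonzero element of `C`, and
whenever `f` is a sum of two elements of `C`, both of them lie on the ray `ℝ≥0 • f`. -/
def GeneratesExtremalRay {E : Type*} [AddCommGroup E] [Module ℝ E] (C : ConvexCone ℝ E)
    (f : E) : Prop :=
  f ∈ C ∧ f ≠ 0 ∧ ∀ g ∈ C, ∀ h ∈ C, g + h = f →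
    (∃ s : ℝ, 0 ≤ s ∧ g = s • f) ∧ (∃ t : ℝ, 0 ≤ t ∧ h = t • f)

end GoodFunctions

end

/-! Up to a constant, the Gaussian is its own Fourier transform. The polar form of `Q` identifies
the space with its dual, and completing the square gives the transform `C * exp (-Q y)` at the
character of `y`, where `C` is the total mass. Positive-definiteness follows because transforms of
nonnegative functions are positive-definite. For a closed subgroup, Haar measure is uniformly
bounded on unit balls, and this suffices to integrate a Gaussian.

Extremality is Hardy's uncertainty principle. If `g + h = f` with both summands good, then `0 ≤ g ≤
f` and `0 ≤ ĝ ≤ f̂`. Fix `y` and let `M z` be the integral of `g x * exp (z * polar Q y x)`. The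
first bound makes `M` entire with `‖M z‖ ≤ C * exp (z.re ^ 2 * Q y)`; the second gives `‖M (I * t)‖
≤ C * exp (-t ^ 2 * Q y)` for real `t`. Hence `M (I * z) * exp (z ^ 2 * Q y)` is bounded by `C` on
the real axis and by `C * exp (z.re ^ 2 * Q y)` everywhere. Phragmén–Lindelöf in quadrants and
Liouville make it constant (`apply_eq_apply_of_norm_le_exp_re_sq`), so `ĝ` is a multiple of `f̂`,
with a factor independent of `y`. Fourier uniqueness concludes. -/

open Filter Topology

/-! ### Positive definite quadratic forms and linear characters -/

namespace QuadraticMap.PosDef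

theorem eq_zero_of_polar_eq_zero {V : Type*} [AddCommGroup V] [Module ℝ V]
    {Q : QuadraticForm ℝ V} (hQ : Q.PosDef) {y : V} (h : ∀ x, QuadraticMap.polar Q y x = 0) : y = 0 := by
  by_contra hy
  have := hQ y hy
  have h1 := h y
  rw [QuadraticMap.polar_self] at h1
  simp at h1
  linarith

variable {V : Type*} [NormedAddCommGroup V] [NormedSpace ℝ V] [FiniteDimensional ℝ V]

theorem _root_.QuadraticForm.continuous (Q : QuadraticForm ℝ V) : Continuous Q := by
  have h : ∀ x, Q x = (1 / 2 : ℝ) * LinearMap.toContinuousLinearMap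
      (LinearMap.toContinuousLinearMap.toLinearMap ∘ₗ Q.polarBilin) x x := by
    intro x
    simp [QuadraticMap.polar_self]
  rw [funext h]
  fun_prop

theorem _root_.QuadraticForm.continuous_polar (Q : QuadraticForm ℝ V) :
    Continuous fun p : V × V => QuadraticMap.polar Q p.1 p.2 := by
  have := QuadraticForm.continuous Q
  unfold QuadraticMap.polar
  fun_prop

variable {Q : QuadraticForm ℝ V}

/-- By homogeneity, the minimum of `Q` on the compact unit sphere serves as `c`; an empty sphere
means a trivial space. -/
theorem exists_mul_norm_sq_le (hQ : Q.PosDef) : ∃ c : ℝ, 0 < c ∧ ∀ x, c * ‖x‖ ^ 2 ≤ Q x := by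
  rcases (Metric.sphere (0 : V) 1).eq_empty_or_nonempty with h | h
  · refine ⟨1, one_pos, fun x => ?_⟩
    have hx : x = 0 := by
      by_contra hx
      have : ‖x‖⁻¹ • x ∈ Metric.sphere (0 : V) 1 := by
        simp [norm_smul, hx]
      simp [h] at this
    simp [hx]
  · obtain ⟨u, hu, hmin⟩ := (isCompact_sphere (0 : V) 1).exists_isMinOn h
      (QuadraticForm.continuous Q).continuousOn
    have hu0 : u ≠ 0 := by rintro rfl; simp at hu
    refine ⟨Q u, hQ u hu0, fun x => ?_⟩
    by_cases hx : x = 0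
    · simp [hx]
    have hx' : ‖x‖ ≠ 0 := norm_ne_zero_iff.2 hx
    have h1 : Q u ≤ Q (‖x‖⁻¹ • x) := hmin (by simp [norm_smul, hx])
    rw [QuadraticMap.map_smul, smul_eq_mul] at h1
    calc Q u * ‖x‖ ^ 2 ≤ (‖x‖⁻¹ * ‖x‖⁻¹ * Q x) * ‖x‖ ^ 2 := by gcongr
      _ = Q x := by field_simp

theorem exists_polar_eq (hQ : Q.PosDef) (L : V →ₗ[ℝ] ℝ) : ∃ y, ∀ x, QuadraticMap.polar Q y x = L x := by
  have hinj : Function.Injective Q.polarBilin := by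
    rw [injective_iff_map_eq_zero]
    intro y hy
    exact hQ.eq_zero_of_polar_eq_zero fun x => by
      simpa using LinearMap.congr_fun hy x
  have hsurj := (LinearMap.injective_iff_surjective_of_finrank_eq_finrank
    (Subspace.dual_finrank_eq (K := ℝ) (V := V)).symm).1 hinj
  obtain ⟨y, hy⟩ := hsurj L
  exact ⟨y, fun x => by simpa using LinearMap.congr_fun hy x⟩

end QuadraticMap.PosDef

theorem QuadraticMap.map_sub_smul_eq {V : Type*} [AddCommGroup V] [Module ℝ V]
    (Q : QuadraticForm ℝ V) (x y : V) (t : ℝ) :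
    Q (x - t • y) = Q x - t * QuadraticMap.polar Q y x + t ^ 2 * Q y := by
  have h := QuadraticMap.map_add Q x (-(t • y))
  rw [← sub_eq_add_neg] at h
  rw [h, QuadraticMap.map_neg, QuadraticMap.map_smul, QuadraticMap.polar_neg_right,
    QuadraticMap.polar_smul_right, QuadraticMap.polar_comm Q x y]
  simp only [smul_eq_mul]
  ring

/-- Every continuous character of a real normed space is `x ↦ exp (i L x)` for a continuous linear
functional `L`. -/
theorem exists_continuousLinearMap_circle_exp_eq {V : Type*} [NormedAddCommGroup V]
    [NormedSpace ℝ V] (χ : V → Circle) (hχ : Continuous χ) (h0 : χ 0 = 1)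
    (hadd : ∀ x y, χ (x + y) = χ x * χ y) : ∃ L : V →L[ℝ] ℝ, ∀ x, χ x = Circle.exp (L x) := by
  -- `V` is simply connected, so the character lifts through the covering `ℝ → Circle`.
  obtain ⟨F, ⟨hF0, hF⟩, -⟩ := Circle.isCoveringMap_exp.existsUnique_continuousMap_lifts
    ⟨χ, hχ⟩ 0 0 (by simp [h0])
  have hF' : ∀ x, Circle.exp (F x) = χ x := fun x => congrFun hF x
  -- Both sides lift the same map on `V × V` and agree at the origin, so uniqueness of lifts makes
  -- `F` additive.
  have key : (fun p : V × V => F (p.1 + p.2)) = fun p => F p.1 + F p.2 := by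
    refine Circle.isCoveringMap_exp.eq_of_comp_eq (by fun_prop) (by fun_prop) ?_ (0, 0)
      (by simp [hF0])
    funext p
    simp [Circle.exp_add, hF', hadd]
  refine ⟨AddMonoidHom.toRealLinearMap
    ⟨⟨F, hF0⟩, fun x y => congrFun key (x, y)⟩ F.continuous, fun x => (hF' x).symm⟩

/-! ### Phragmén–Lindelöf and Liouville -/

/-- Phragmén–Lindelöf in the open first quadrant, at the critical order of growth. -/
theorem norm_le_of_first_quadrant {F : ℂ → ℂ} (hF : Differentiable ℂ F) {C q : ℝ} (hC : 0 ≤ C)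
    (hq : 0 ≤ q) (hgrowth : ∀ z : ℂ, ‖F z‖ ≤ C * Real.exp (q * z.re ^ 2))
    (hreal : ∀ x : ℝ, ‖F x‖ ≤ C) {z : ℂ} (hre : 0 < z.re) (him : 0 < z.im) : ‖F z‖ ≤ C := by
  have hz0 : z ≠ 0 := by rintro rfl; simp at hre
  have harg0 : 0 ≤ z.arg := Complex.arg_nonneg_iff.2 him.le
  have harg1 : z.arg < Real.pi / 2 := Complex.arg_lt_pi_div_two_iff.2 (Or.inl hre)
  have hnorm : ∀ (a : ℝ) (w : ℂ), ‖Complex.exp (Complex.I * a * w ^ 2)‖ =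
      Real.exp (-(2 * a * w.re * w.im)) := by
    intro a w
    rw [Complex.norm_exp]
    congr 1
    simp [pow_two]
    ring
  -- The factor `exp (I * a * w ^ 2)` has modulus one on the real axis and decays inside the
  -- quadrant; its cost at `z` disappears as `a → 0`.
  have key : ∀ a : ℝ, 0 < a → ‖F z‖ ≤ C * Real.exp (2 * a * z.re * z.im) := by
    intro a ha
    -- Near the imaginary axis the decay rate beats the growth `q * w.re ^ 2`. The ray of angle `φ`
    -- is chosen there, above `z`.
    have hev : ∀ᶠ φ in 𝓝[<] (Real.pi / 2), q * Real.cos φ < 2 * a * Real.sin φ := by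
      refine nhdsWithin_le_nhds ?_
      have h1 : Continuous fun φ => q * Real.cos φ := by fun_prop
      have h2 : Continuous fun φ => 2 * a * Real.sin φ := by fun_prop
      refine (isOpen_lt h1 h2).mem_nhds ?_
      simp [ha]
    obtain ⟨φ, hφ, hφ1, hφ2⟩ :=
      (hev.and (Ioo_mem_nhdsLT harg1)).exists
    have hφ0 : 0 < φ := harg0.trans_lt hφ1
    have hsin : 0 < Real.sin φ := Real.sin_pos_of_pos_of_lt_pi hφ0 (by linarith [Real.pi_pos])
    have hcos : 0 < Real.cos φ := Real.cos_pos_of_mem_Ioo ⟨by linarith, hφ2⟩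
    -- The exponential turns the sector `0 ≤ arg ≤ φ` into a horizontal strip of width `φ`.
    let H : ℂ → ℂ := fun w => F (Complex.exp w) * Complex.exp (Complex.I * a * Complex.exp w ^ 2)
    have hHdiff : Differentiable ℂ H :=
      (hF.comp Complex.differentiable_exp).mul (by fun_prop)
    have hmain : ‖H (Complex.log z)‖ ≤ C := by
      refine PhragmenLindelof.horizontal_strip (a := 0) (b := φ) (f := H) hHdiff.diffContOnCl
        ⟨2, ?_, q + a, ?_⟩ ?_ ?_ ?_ ?_
      -- Order 2 is critical for the full quadrant but admissible here: `2 < π / φ` because `φ < π /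
      -- 2`.
      · rw [sub_zero, lt_div_iff₀ hφ0]; linarith
      · refine Asymptotics.IsBigO.of_bound C (Eventually.of_forall fun w => ?_)
        have hr : ‖Complex.exp w‖ ^ 2 ≤ Real.exp (2 * |w.re|) := by
          rw [Complex.norm_exp, ← Real.exp_nat_mul]
          exact Real.exp_le_exp.2 (by push_cast; linarith [le_abs_self w.re])
        have hsq : ‖Complex.exp w‖ ^ 2 = (Complex.exp w).re ^ 2 + (Complex.exp w).im ^ 2 := by
          rw [← Complex.normSq_eq_norm_sq, Complex.normSq_apply]; ring
        have hle : q * (Complex.exp w).re ^ 2 +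
            -(2 * a * (Complex.exp w).re * (Complex.exp w).im) ≤
            (q + a) * Real.exp (2 * |w.re|) := by
          have h1 : q * (Complex.exp w).re ^ 2 ≤ q * ‖Complex.exp w‖ ^ 2 := by
            rw [hsq]; gcongr; nlinarith [sq_nonneg (Complex.exp w).im]
          have h2 : -(2 * a * (Complex.exp w).re * (Complex.exp w).im) ≤
              a * ‖Complex.exp w‖ ^ 2 := by
            rw [hsq]
            have := mul_nonneg ha.le (sq_nonneg ((Complex.exp w).re + (Complex.exp w).im))
            nlinarith
          calc _ ≤ (q + a) * ‖Complex.exp w‖ ^ 2 := by linarith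
            _ ≤ _ := by gcongr
        calc ‖H w‖ = ‖F (Complex.exp w)‖ *
              Real.exp (-(2 * a * (Complex.exp w).re * (Complex.exp w).im)) := by
              rw [norm_mul, hnorm]
          _ ≤ C * Real.exp (q * (Complex.exp w).re ^ 2) *
              Real.exp (-(2 * a * (Complex.exp w).re * (Complex.exp w).im)) := by
              gcongr; exact hgrowth _
          _ = C * Real.exp (q * (Complex.exp w).re ^ 2 +
              -(2 * a * (Complex.exp w).re * (Complex.exp w).im)) := by
              rw [Real.exp_add, mul_assoc]
          _ ≤ C * Real.exp ((q + a) * Real.exp (2 * |w.re|)) := by gcongr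
          _ = _ := by rw [Real.norm_of_nonneg (Real.exp_pos _).le]
      · intro w hw
        have hexp : Complex.exp w = (Real.exp w.re : ℝ) := by
          conv_lhs => rw [← Complex.re_add_im w, hw]
          simp
        rw [norm_mul, hnorm, hexp]
        simpa using hreal (Real.exp w.re)
      · intro w hw
        rw [norm_mul, hnorm]
        have h1 : (Complex.exp w).re = Real.exp w.re * Real.cos φ := by rw [Complex.exp_re, hw]
        have h2 : (Complex.exp w).im = Real.exp w.re * Real.sin φ := by rw [Complex.exp_im, hw]
        calc _ ≤ C * Real.exp (q * (Complex.exp w).re ^ 2) *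
              Real.exp (-(2 * a * (Complex.exp w).re * (Complex.exp w).im)) := by
              gcongr; exact hgrowth _
          _ = C * Real.exp (Real.exp w.re ^ 2 * Real.cos φ *
              (q * Real.cos φ - 2 * a * Real.sin φ)) := by
              rw [mul_assoc, ← Real.exp_add, h1, h2]; ring_nf
          _ ≤ C * 1 := by
              gcongr
              rw [Real.exp_le_one_iff]
              exact mul_nonpos_of_nonneg_of_nonpos (by positivity) (by linarith)
          _ = C := mul_one C
      · rw [Complex.log_im]; exact harg0
      · rw [Complex.log_im]; exact hφ1.le
    simp only [H] at hmain
    rw [norm_mul, Complex.exp_log hz0, hnorm, Real.exp_neg, ← div_eq_mul_inv,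
      div_le_iff₀ (Real.exp_pos _)] at hmain
    exact hmain
  have hlim : Tendsto (fun a : ℝ => C * Real.exp (2 * a * z.re * z.im)) (𝓝[>] 0) (𝓝 C) := by
    have : Continuous fun a : ℝ => C * Real.exp (2 * a * z.re * z.im) := by fun_prop
    simpa using (this.tendsto 0).mono_left nhdsWithin_le_nhds
  exact ge_of_tendsto hlim (eventually_nhdsWithin_of_forall fun a ha => key a ha)

/-- The complex-analytic core of Hardy's uncertainty principle. -/
theorem apply_eq_apply_of_norm_le_exp_re_sq {F : ℂ → ℂ} (hF : Differentiable ℂ F) {C q : ℝ}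
    (hq : 0 ≤ q) (hgrowth : ∀ z : ℂ, ‖F z‖ ≤ C * Real.exp (q * z.re ^ 2))
    (hreal : ∀ x : ℝ, ‖F x‖ ≤ C) (z w : ℂ) : F z = F w := by
  have hC : 0 ≤ C := (norm_nonneg _).trans (hreal 0)
  have right : ∀ {G : ℂ → ℂ}, Differentiable ℂ G →
      (∀ z : ℂ, ‖G z‖ ≤ C * Real.exp (q * z.re ^ 2)) → (∀ x : ℝ, ‖G x‖ ≤ C) →
      ∀ z : ℂ, 0 < z.re → ‖G z‖ ≤ C := by
    intro G hG h1 h2 z hz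
    rcases lt_trichotomy z.im 0 with h | h | h
    -- Reflection in the real axis carries the fourth quadrant to the first.
    · have := norm_le_of_first_quadrant (F := fun z => conj (G (conj z)))
        (fun z => by
          have := (hG (conj z)).conj_conj
          rwa [Complex.conj_conj] at this) hC hq
        (fun z => by simpa using h1 (conj z)) (fun x => by simpa using h2 x)
        (z := conj z) (by simpa using hz) (by simpa using h)
      simpa using this
    · have hzr : z = (z.re : ℂ) := Complex.ext (by simp) (by simp [h])
      rw [hzr]; exact h2 _
    · exact norm_le_of_first_quadrant hG hC hq h1 h2 hz h
  refine hF.apply_eq_apply_of_bounded (isBounded_iff_forall_norm_le.2 ⟨C, ?_⟩) z w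
  rintro _ ⟨z, rfl⟩
  rcases lt_trichotomy z.re 0 with h | h | h
  · have := right (G := fun z => F (-z)) (hF.comp differentiable_neg)
      (fun z => by simpa using hgrowth (-z)) (fun x => by simpa using hreal (-x)) (-z)
      (by simpa using h)
    simpa using this
  -- On the imaginary axis the growth bound is already `C`.
  · simpa [h] using hgrowth z
  · exact right hF hgrowth hreal z h

/-! ### Gaussian integrability for measures bounded on unit balls -/

section Gaussian

variable {V : Type*} [NormedAddCommGroup V] [InnerProductSpace ℝ V] [FiniteDimensional ℝ V]
  [MeasurableSpace V] [BorelSpace V]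

/-- A Gaussian is integrable for every measure that is uniformly bounded on unit balls. -/
theorem integrable_exp_neg_mul_norm_sq_of_measure_ball_le (ν : Measure V) {C : ENNReal}
    (hC : C ≠ ⊤) (hν : ∀ x, ν (Metric.ball x 1) ≤ C) {c : ℝ} (hc : 0 < c) :
    Integrable (fun x => Real.exp (-(c * ‖x‖ ^ 2))) ν := by
  have : IsLocallyFiniteMeasure ν :=
    ⟨fun x => ⟨Metric.ball x 1, Metric.ball_mem_nhds x one_pos, (hν x).trans_lt hC.lt_top⟩⟩
  -- The rate is halved because `‖x‖ ^ 2 ≤ 2 * ‖h‖ ^ 2 + 2` on the unit ball about `h`: there `ψ x ≥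
  -- exp (-c) * exp (-(c * ‖h‖ ^ 2))`.
  let ψ : V → ENNReal := fun x => ENNReal.ofReal (Real.exp (-(c / 2 * ‖x‖ ^ 2)))
  have hψm : Measurable ψ := by fun_prop
  have hψ : ∫⁻ x, ψ x < ⊤ := by
    have h := (GaussianFourier.integrable_cexp_neg_mul_sq_norm_add (V := V) (b := (c / 2 : ℝ))
      (by simpa using hc) 0 0).norm
    have h2 : Integrable (fun x : V => Real.exp (-(c / 2 * ‖x‖ ^ 2))) := by
      refine h.congr (Eventually.of_forall fun x => ?_)
      simp only [Complex.norm_exp]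
      congr 1
      simp [← Complex.ofReal_pow]
    exact h2.lintegral_lt_top
  let S : Set (V × V) := {p | dist p.2 p.1 < 1}
  have hS : MeasurableSet S :=
    (isOpen_lt (by fun_prop) (by fun_prop)).measurableSet
  let k : V × V → ENNReal := S.indicator fun p => ψ p.2
  have hk : Measurable k := (hψm.comp measurable_snd).indicator hS
  -- Tonelli: integrating over `h` first, each `x` is counted with weight at most `C`.
  have h1 : ∫⁻ h, ∫⁻ x, k (h, x) ∂volume ∂ν ≤ C * ∫⁻ x, ψ x := by
    rw [lintegral_lintegral_swap (f := fun h x => k (h, x)) hk.aemeasurable]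
    calc ∫⁻ x, ∫⁻ h, k (h, x) ∂ν ∂volume ≤ ∫⁻ x, C * ψ x := by
          refine lintegral_mono fun x => ?_
          have : ∀ h, k (h, x) = (Metric.ball x 1).indicator (fun _ => ψ x) h := by
            classical
            intro h
            simp [k, S, Set.indicator_apply, dist_comm]
          simp_rw [this]
          rw [lintegral_indicator_const Metric.isOpen_ball.measurableSet, mul_comm]
          exact mul_le_mul_left (hν x) _
      _ = C * ∫⁻ x, ψ x := lintegral_const_mul _ hψm
  let v : ENNReal := volume (Metric.ball (0 : V) 1)
  have hv : v ≠ 0 := (Metric.isOpen_ball.measure_pos _ ⟨0, by simp⟩).ne'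
  let e : ENNReal := ENNReal.ofReal (Real.exp (-c))
  have he : e ≠ 0 := by simp [e, Real.exp_pos]
  have h2 : ∀ h, e * v * ENNReal.ofReal (Real.exp (-(c * ‖h‖ ^ 2))) ≤
      ∫⁻ x, k (h, x) ∂volume := by
    intro h
    have : ∀ x, k (h, x) = (Metric.ball h 1).indicator ψ x := fun x => by
      classical
      simp [k, S, Set.indicator_apply]
    simp_rw [this]
    rw [lintegral_indicator Metric.isOpen_ball.measurableSet]
    calc _ = ∫⁻ x in Metric.ball h 1, e * ENNReal.ofReal (Real.exp (-(c * ‖h‖ ^ 2))) := by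
          rw [setLIntegral_const, Measure.addHaar_ball_center volume h 1]
          simp only [v]; ring
      _ ≤ _ := by
          refine setLIntegral_mono hψm fun x hx => ?_
          simp only [e, ψ]
          rw [← ENNReal.ofReal_mul (Real.exp_pos _).le, ← Real.exp_add]
          refine ENNReal.ofReal_le_ofReal (Real.exp_le_exp.2 ?_)
          have hx1 : ‖x‖ ≤ ‖h‖ + 1 := by
            have := norm_add_le (x - h) h
            rw [sub_add_cancel] at this
            have hx' := mem_ball_iff_norm.1 hx
            linarith
          have hx2 : ‖x‖ ^ 2 ≤ 2 * ‖h‖ ^ 2 + 2 := by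
            nlinarith [norm_nonneg x, norm_nonneg h, sq_nonneg (‖h‖ - 1)]
          nlinarith
  have h3 : e * v * ∫⁻ h, ENNReal.ofReal (Real.exp (-(c * ‖h‖ ^ 2))) ∂ν < ⊤ := by
    rw [← lintegral_const_mul _ (by fun_prop)]
    exact ((lintegral_mono h2).trans h1).trans_lt (ENNReal.mul_lt_top hC.lt_top hψ)
  refine ⟨by fun_prop, ?_⟩
  rw [hasFiniteIntegral_iff_ofReal (Eventually.of_forall fun x => (Real.exp_pos _).le)]
  exact ENNReal.lt_top_of_mul_ne_top_right h3.ne (mul_ne_zero he hv)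

theorem QuadraticMap.PosDef.integrable_exp_neg_of_measure_ball_le {Q : QuadraticForm ℝ V}
    (hQ : Q.PosDef) (ν : Measure V) {C : ENNReal}
    (hC : C ≠ ⊤) (hν : ∀ x, ν (Metric.ball x 1) ≤ C) :
    Integrable (fun x => Real.exp (-Q x)) ν := by
  obtain ⟨c, hc, hcQ⟩ := hQ.exists_mul_norm_sq_le
  have hcont := QuadraticForm.continuous Q
  refine (integrable_exp_neg_mul_norm_sq_of_measure_ball_le ν hC hν hc).mono'
    (by fun_prop) (Eventually.of_forall fun x => ?_)
  rw [Real.norm_of_nonneg (Real.exp_pos _).le]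
  exact Real.exp_le_exp.2 (neg_le_neg (hcQ x))

/-- A Gaussian is integrable along every proper map `j` for which the measure of the preimages of
balls of radius `2` about points of the range does not depend on the centre. -/
theorem QuadraticMap.PosDef.integrable_exp_neg_comp {Q : QuadraticForm ℝ V}
    (hQ : Q.PosDef) {K : Type*} [TopologicalSpace K] [MeasurableSpace K] [BorelSpace K]
    (μ : Measure K) [IsFiniteMeasureOnCompacts μ] (j : K → V) (hj : Continuous j)
    (hproper : IsCompact (j ⁻¹' Metric.closedBall 0 2))
    (hinv : ∀ k₀, μ {k | j k - j k₀ ∈ Metric.closedBall (0 : V) 2} =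
      μ (j ⁻¹' Metric.closedBall 0 2)) :
    Integrable (fun k => Real.exp (-Q (j k))) μ := by
  have hint := hQ.integrable_exp_neg_of_measure_ball_le (μ.map j)
    (C := μ (j ⁻¹' Metric.closedBall 0 2)) hproper.measure_lt_top.ne ?_
  · exact hint.comp_measurable hj.measurable
  intro x
  rw [Measure.map_apply hj.measurable Metric.isOpen_ball.measurableSet]
  rcases (j ⁻¹' Metric.ball x 1).eq_empty_or_nonempty with h | ⟨k₀, hk₀⟩
  · simp [h]
  -- The centre `x` need not lie in the range of `j`; doubling the radius recentres the ball at `j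
  -- k₀`.
  rw [← hinv k₀]
  refine measure_mono fun k hk => ?_
  simp only [Set.mem_preimage, Set.mem_ofPred_eq, mem_closedBall_zero_iff] at *
  rw [mem_ball_iff_norm] at hk hk₀
  have := norm_sub_le (j k - x) (j k₀ - x)
  rw [sub_sub_sub_cancel_right] at this
  linarith

end Gaussian

/-! ### The dual group through the polar form -/

noncomputable section
namespace GoodFunctions

section Dual

variable {V : Type*} [NormedAddCommGroup V] [NormedSpace ℝ V] [FiniteDimensional ℝ V]

/-- The character `x ↦ exp (i · polar Q y x)` of `V`, as a homomorphism in `y`. -/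
def polarCharacter (Q : QuadraticForm ℝ V) : Multiplicative V →* Dual V where
  toFun y :=
    ({ toFun := fun x => Circle.exp (QuadraticMap.polar Q y.toAdd x.toAdd)
       map_one' := by simp
       map_mul' := fun x x' => by
        rw [toAdd_mul, QuadraticMap.polar_add_right, Circle.exp_add]
       continuous_toFun := by
        have h := QuadraticForm.continuous_polar Q
        exact Circle.exp.continuous.comp
          (h.comp (continuous_const.prodMk continuous_toAdd)) } : Multiplicative V →ₜ* Circle)
  map_one' := by
    apply PontryaginDual.ext
    intro x
    change Circle.exp (QuadraticMap.polar Q 0 x.toAdd) = 1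
    simp
  map_mul' y y' := by
    apply PontryaginDual.ext
    intro x
    change Circle.exp (QuadraticMap.polar Q (y.toAdd + y'.toAdd) x.toAdd) =
      Circle.exp (QuadraticMap.polar Q y.toAdd x.toAdd) *
      Circle.exp (QuadraticMap.polar Q y'.toAdd x.toAdd)
    rw [QuadraticMap.polar_add_left, Circle.exp_add]

theorem polarCharacter_apply (Q : QuadraticForm ℝ V) (y x : V) :
    polarCharacter Q (.ofAdd y) (.ofAdd x) = Circle.exp (QuadraticMap.polar Q y x) := rfl

theorem continuous_polarCharacter (Q : QuadraticForm ℝ V) : Continuous (polarCharacter Q) := by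
  have h := QuadraticForm.continuous_polar Q
  refine ContinuousMonoidHom.continuous_of_continuous_uncurry (A := Multiplicative V)
    (polarCharacter Q) ?_
  exact Circle.exp.continuous.comp
    (h.comp ((continuous_toAdd.comp continuous_fst).prodMk (continuous_toAdd.comp continuous_snd)))

theorem polarCharacter_bijective {Q : QuadraticForm ℝ V} (hQ : Q.PosDef) :
    Function.Bijective (polarCharacter Q) := by
  constructor
  · rw [injective_iff_map_eq_one]
    intro y hy
    have h1 : ∀ x : V, Circle.exp (QuadraticMap.polar Q y.toAdd x) = 1 := fun x =>
      DFunLike.congr_fun hy (Multiplicative.ofAdd x)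
    -- A continuous lift of the trivial character that vanishes at `0` is zero.
    have h2 : (fun x : V => QuadraticMap.polar Q y.toAdd x) = fun _ => 0 := by
      have h := QuadraticForm.continuous_polar Q
      refine Circle.isCoveringMap_exp.eq_of_comp_eq
        (h.comp (continuous_const.prodMk continuous_id)) continuous_const ?_ 0 (by simp)
      funext x
      simp [h1]
    exact QuadraticMap.PosDef.eq_zero_of_polar_eq_zero hQ fun x => congrFun h2 x
  · intro χ
    obtain ⟨L, hL⟩ := exists_continuousLinearMap_circle_exp_eq
      (fun x : V => χ (Multiplicative.ofAdd x)) ((map_continuous χ).comp continuous_ofAdd)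
      (map_one χ) (fun x y => map_mul χ _ _)
    obtain ⟨y, hy⟩ := QuadraticMap.PosDef.exists_polar_eq hQ (L : V →ₗ[ℝ] ℝ)
    refine ⟨Multiplicative.ofAdd y, PontryaginDual.ext fun x => ?_⟩
    have := hL x.toAdd
    change Circle.exp (QuadraticMap.polar Q y x.toAdd) = _
    rw [hy]
    exact this.symm

/-- A positive definite quadratic form identifies a finite-dimensional real vector space with its
dual group, topologically. -/
def polarHomeomorph {Q : QuadraticForm ℝ V} (hQ : Q.PosDef) : Multiplicative V ≃ₜ Dual V :=
  have : SigmaCompactSpace (Multiplicative V) := inferInstanceAs (SigmaCompactSpace V)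
  (Equiv.ofBijective _ (polarCharacter_bijective hQ)).toHomeomorphOfContinuousOpen
    (continuous_polarCharacter Q)
    (MonoidHom.isOpenMap_of_sigmaCompact _ (polarCharacter_bijective hQ).2
      (continuous_polarCharacter Q))

/-- The vector that represents a character through the polar form of `Q`. -/
def polarVector {Q : QuadraticForm ℝ V} (hQ : Q.PosDef) (χ : Dual V) : V :=
  ((polarHomeomorph hQ).symm χ).toAdd

theorem continuous_polarVector {Q : QuadraticForm ℝ V} (hQ : Q.PosDef) :
    Continuous (polarVector hQ) :=
  continuous_toAdd.comp (polarHomeomorph hQ).symm.continuous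

theorem polarCharacter_polarVector {Q : QuadraticForm ℝ V} (hQ : Q.PosDef) (χ : Dual V) :
    polarCharacter Q (.ofAdd (polarVector hQ χ)) = χ :=
  (polarHomeomorph hQ).apply_symm_apply χ

theorem polarVector_polarCharacter {Q : QuadraticForm ℝ V} (hQ : Q.PosDef) (y : V) :
    polarVector hQ (polarCharacter Q (.ofAdd y)) = y :=
  (polarHomeomorph hQ).symm_apply_apply (Multiplicative.ofAdd y)

theorem polarVector_inv_mul {Q : QuadraticForm ℝ V} (hQ : Q.PosDef) (χ ψ : Dual V) :
    polarVector hQ (χ⁻¹ * ψ) = polarVector hQ ψ - polarVector hQ χ := by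
  conv_lhs => rw [← polarCharacter_polarVector hQ χ, ← polarCharacter_polarVector hQ ψ,
    ← map_inv, ← map_mul, ← ofAdd_neg, ← ofAdd_add, polarVector_polarCharacter, neg_add_eq_sub]

theorem isCompact_preimage_polarVector {Q : QuadraticForm ℝ V} (hQ : Q.PosDef) {s : Set V}
    (hs : IsCompact s) : IsCompact (polarVector hQ ⁻¹' s) :=
  (polarHomeomorph hQ).symm.isClosedEmbedding.isCompact_preimage
    (K := Multiplicative.toAdd ⁻¹' s) hs

end Dual

/-! ### Integrability over closed subgroups -/

section Gaussian

variable {V : Type*} [NormedAddCommGroup V] [InnerProductSpace ℝ V] [FiniteDimensional ℝ V]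
  [MeasurableSpace V] [BorelSpace V]

theorem integrable_exp_neg {Q : QuadraticForm ℝ V} (hQ : Q.PosDef) :
    Integrable (fun x => Real.exp (-Q x)) (Measure.addHaar : Measure V) :=
  hQ.integrable_exp_neg_of_measure_ball_le _ measure_ball_lt_top.ne
    (fun x => (Measure.addHaar_ball_center _ x 1).le)

/-- Closedness makes the inclusion proper, and Haar invariance makes the measure of balls about
points of `H` independent of the centre. -/
theorem integrable_exp_neg_addSubgroup {Q : QuadraticForm ℝ V} (hQ : Q.PosDef) (H : AddSubgroup V)
    (hH : IsClosed (H : Set V)) (μ : Measure H) [μ.IsAddHaarMeasure] :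
    Integrable (fun x : H => Real.exp (-Q x)) μ := by
  refine hQ.integrable_exp_neg_comp μ (fun x : H => (x : V)) continuous_subtype_val
    (hH.isClosedEmbedding_subtypeVal.isCompact_preimage (isCompact_closedBall 0 2)) fun k₀ => ?_
  refine (congrArg μ ?_).trans (measure_preimage_add μ (-k₀) _)
  ext k
  simp [neg_add_eq_sub]

theorem integrable_exp_neg_polarVector {Q : QuadraticForm ℝ V} (hQ : Q.PosDef)
    (K : Subgroup (Dual V)) (hK : IsClosed (K : Set (Dual V))) (μ : Measure K) [μ.IsHaarMeasure] :
    Integrable (fun χ : K => Real.exp (-Q (polarVector hQ χ))) μ := by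
  refine hQ.integrable_exp_neg_comp μ (fun χ : K => polarVector hQ χ)
    ((continuous_polarVector hQ).comp continuous_subtype_val)
    (hK.isClosedEmbedding_subtypeVal.isCompact_preimage
      (isCompact_preimage_polarVector hQ (isCompact_closedBall 0 2))) fun k₀ => ?_
  refine (congrArg μ ?_).trans (measure_preimage_mul μ k₀⁻¹ _)
  ext k
  simp [polarVector_inv_mul]

theorem integrable_exp_neg_polarVector_dual {Q : QuadraticForm ℝ V} (hQ : Q.PosDef) :
    Integrable (fun χ : Dual V => Real.exp (-Q (polarVector hQ χ))) Measure.haar := by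
  refine hQ.integrable_exp_neg_comp _ (polarVector hQ) (continuous_polarVector hQ)
    (isCompact_preimage_polarVector hQ (isCompact_closedBall 0 2)) fun k₀ => ?_
  refine (congrArg _ ?_).trans (measure_preimage_mul _ k₀⁻¹ _)
  ext k
  simp [polarVector_inv_mul]

end Gaussian
end GoodFunctions
end

/-! ### Fourier and Laplace transforms of densities -/

noncomputable section
namespace GoodFunctions

theorem complexMGF_polar_smul {V : Type*} [AddCommGroup V] [Module ℝ V] [MeasurableSpace V]
    (Q : QuadraticForm ℝ V) (μ : Measure V) (y : V) (t : ℝ) (z : ℂ) :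
    ProbabilityTheory.complexMGF (QuadraticMap.polar Q (t • y)) μ z =
      ProbabilityTheory.complexMGF (QuadraticMap.polar Q y) μ (z * t) := by
  simp [ProbabilityTheory.complexMGF, QuadraticMap.polar_smul_left, mul_assoc]

/-- Completing the square: an exponential tilt of the Gaussian is a scaled translate of it. -/
theorem exp_mul_polar_mul_exp_neg {V : Type*} [AddCommGroup V] [Module ℝ V]
    (Q : QuadraticForm ℝ V) (x y : V) (t : ℝ) :
    Real.exp (t * QuadraticMap.polar Q y x) * Real.exp (-Q x) =
      Real.exp (t ^ 2 * Q y) * Real.exp (-Q (x - t • y)) := by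
  rw [← Real.exp_add, ← Real.exp_add, QuadraticMap.map_sub_smul_eq]
  ring_nf

theorem continuous_polar_right {V : Type*} [NormedAddCommGroup V] [NormedSpace ℝ V]
    [FiniteDimensional ℝ V] (Q : QuadraticForm ℝ V) (y : V) :
    Continuous (QuadraticMap.polar Q y) :=
  (QuadraticForm.continuous_polar Q).comp (continuous_const.prodMk continuous_id)

theorem continuous_exp_neg {V : Type*} [NormedAddCommGroup V] [NormedSpace ℝ V]
    [FiniteDimensional ℝ V] (Q : QuadraticForm ℝ V) : Continuous fun x => Real.exp (-Q x) :=
  Real.continuous_exp.comp (QuadraticForm.continuous Q).neg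

variable {V : Type*} [NormedAddCommGroup V] [InnerProductSpace ℝ V] [FiniteDimensional ℝ V]
  [MeasurableSpace V] [BorelSpace V]

/-- The measure with density `g` with respect to the Haar measure. -/
def densityMeasure (g : V → ℝ) : Measure V :=
  (Measure.addHaar : Measure V).withDensity fun x => ENNReal.ofReal (g x)

theorem isFiniteMeasure_densityMeasure {g : V → ℝ}
    (hg : Integrable g (Measure.addHaar : Measure V)) : IsFiniteMeasure (densityMeasure g) :=
  isFiniteMeasure_withDensity_ofReal hg.2

theorem integral_densityMeasure {E : Type*} [NormedAddCommGroup E] [NormedSpace ℝ E] {g : V → ℝ}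
    (hg0 : ∀ x, 0 ≤ g x) (hg : Measurable g) (F : V → E) :
    ∫ x, F x ∂densityMeasure g = ∫ x, g x • F x ∂(Measure.addHaar : Measure V) := by
  rw [densityMeasure, integral_withDensity_eq_integral_toReal_smul (by fun_prop)
    (Eventually.of_forall fun x => ENNReal.ofReal_lt_top)]
  simp_rw [ENNReal.toReal_ofReal (hg0 _)]

/-- This embeds the Fourier transform in an entire function; rescaling `y` with
`complexMGF_polar_smul` reaches the rest of the imaginary axis. -/
theorem fourierTransform_polarCharacter (Q : QuadraticForm ℝ V) {g : V → ℝ}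
    (hg0 : ∀ x, 0 ≤ g x) (hg : Measurable g) (y : V) :
    fourierTransform g (polarCharacter Q (.ofAdd y)) =
      ProbabilityTheory.complexMGF (QuadraticMap.polar Q y) (densityMeasure g) (-Complex.I) := by
  rw [fourierTransform, ProbabilityTheory.complexMGF, integral_densityMeasure hg0 hg]
  refine integral_congr_ae (Eventually.of_forall fun x => ?_)
  simp only [polarCharacter_apply]
  rw [Circle.coe_exp, ← Complex.exp_conj, mul_comm, Complex.real_smul]
  simp [mul_comm]

theorem eq_of_fourierTransform_eq {Q : QuadraticForm ℝ V} (hQ : Q.PosDef)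
    {g h : V → ℝ} (hg0 : ∀ x, 0 ≤ g x) (hh0 : ∀ x, 0 ≤ h x) (hg : Continuous g)
    (hh : Continuous h) (hgi : Integrable g (Measure.addHaar : Measure V))
    (hhi : Integrable h (Measure.addHaar : Measure V))
    (heq : fourierTransform g = fourierTransform h) : g = h := by
  have := isFiniteMeasure_densityMeasure hgi
  have := isFiniteMeasure_densityMeasure hhi
  have hμ : densityMeasure g = densityMeasure h := by
    refine Measure.ext_of_charFun (funext fun t => ?_)
    -- The sign reconciles `charFun`, which uses `exp (i⟨x, t⟩)`, with the conjugated character in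
    -- the Fourier transform.
    obtain ⟨y, hy⟩ := hQ.exists_polar_eq (-(innerₗ V t))
    have key : ∀ μ : Measure V, charFun μ t =
        ProbabilityTheory.complexMGF (QuadraticMap.polar Q y) μ (-Complex.I) := by
      intro μ
      simp only [charFun_apply, ProbabilityTheory.complexMGF]
      refine integral_congr_ae (Eventually.of_forall fun x => ?_)
      simp [hy, real_inner_comm, mul_comm]
    rw [key, key, ← fourierTransform_polarCharacter Q hg0 hg.measurable,
      ← fourierTransform_polarCharacter Q hh0 hh.measurable, heq]
  rw [densityMeasure, densityMeasure, withDensity_eq_iff_of_sigmaFinite (by fun_prop)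
    (by fun_prop)] at hμ
  refine (Continuous.ae_eq_iff_eq (Measure.addHaar : Measure V) hg hh).1 ?_
  filter_upwards [hμ] with x hx
  exact (ENNReal.ofReal_eq_ofReal_iff (hg0 x) (hh0 x)).1 hx

section Gaussian

variable {Q : QuadraticForm ℝ V}

theorem integrable_exp_mul_polar_mul_exp_neg (hQ : Q.PosDef) (y : V) (t : ℝ) :
    Integrable (fun x => Real.exp (t * QuadraticMap.polar Q y x) * Real.exp (-Q x))
      (Measure.addHaar : Measure V) := by
  simp_rw [exp_mul_polar_mul_exp_neg]
  exact ((integrable_exp_neg hQ).comp_sub_right (t • y)).const_mul _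

theorem integral_exp_mul_polar_mul_exp_neg (Q : QuadraticForm ℝ V) (y : V) (t : ℝ) :
    ∫ x, Real.exp (t * QuadraticMap.polar Q y x) * Real.exp (-Q x)
      ∂(Measure.addHaar : Measure V) =
    (∫ x, Real.exp (-Q x) ∂(Measure.addHaar : Measure V)) * Real.exp (t ^ 2 * Q y) := by
  simp_rw [exp_mul_polar_mul_exp_neg]
  rw [integral_const_mul, integral_sub_right_eq_self (fun x => Real.exp (-Q x)), mul_comm]

theorem integral_exp_neg_pos (hQ : Q.PosDef) :
    0 < ∫ x, Real.exp (-Q x) ∂(Measure.addHaar : Measure V) :=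
  integral_exp_pos (integrable_exp_neg hQ)

variable {g : V → ℝ}

theorem integrable_mul_exp_mul_polar (hQ : Q.PosDef) (hg0 : ∀ x, 0 ≤ g x) (hg : Continuous g)
    (hgQ : ∀ x, g x ≤ Real.exp (-Q x)) (y : V) (t : ℝ) :
    Integrable (fun x => g x * Real.exp (t * QuadraticMap.polar Q y x))
      (Measure.addHaar : Measure V) := by
  have hc := continuous_polar_right Q y
  refine (integrable_exp_mul_polar_mul_exp_neg hQ y t).mono' (by fun_prop)
    (Eventually.of_forall fun x => ?_)
  rw [Real.norm_of_nonneg (mul_nonneg (hg0 x) (Real.exp_pos _).le), mul_comm]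
  gcongr
  exact hgQ x

theorem integrableExpSet_densityMeasure (hQ : Q.PosDef) (hg0 : ∀ x, 0 ≤ g x) (hg : Continuous g)
    (hgQ : ∀ x, g x ≤ Real.exp (-Q x)) (y : V) :
    ProbabilityTheory.integrableExpSet (QuadraticMap.polar Q y) (densityMeasure g) = Set.univ := by
  refine Set.eq_univ_of_forall fun t => ?_
  change Integrable (fun x => Real.exp (t * QuadraticMap.polar Q y x)) (densityMeasure g)
  rw [densityMeasure, integrable_withDensity_iff_integrable_smul' (by fun_prop)
    (Eventually.of_forall fun x => ENNReal.ofReal_lt_top)]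
  simp_rw [ENNReal.toReal_ofReal (hg0 _)]
  exact integrable_mul_exp_mul_polar hQ hg0 hg hgQ y t

/-- Domination by a Gaussian makes all exponential moments finite, so the strip of holomorphy is the
whole plane. -/
theorem differentiable_complexMGF (hQ : Q.PosDef) (hg0 : ∀ x, 0 ≤ g x) (hg : Continuous g)
    (hgQ : ∀ x, g x ≤ Real.exp (-Q x)) (y : V) :
    Differentiable ℂ
      (ProbabilityTheory.complexMGF (QuadraticMap.polar Q y) (densityMeasure g)) := by
  have := ProbabilityTheory.differentiableOn_complexMGF (X := QuadraticMap.polar Q y)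
    (μ := densityMeasure g)
  rw [integrableExpSet_densityMeasure hQ hg0 hg hgQ] at this
  simpa [differentiableOn_univ] using this

theorem norm_complexMGF_le (hQ : Q.PosDef) (hg0 : ∀ x, 0 ≤ g x) (hg : Continuous g)
    (hgQ : ∀ x, g x ≤ Real.exp (-Q x)) (y : V) (z : ℂ) :
    ‖ProbabilityTheory.complexMGF (QuadraticMap.polar Q y) (densityMeasure g) z‖ ≤
      (∫ x, Real.exp (-Q x) ∂(Measure.addHaar : Measure V)) * Real.exp (z.re ^ 2 * Q y) := by
  refine ProbabilityTheory.norm_complexMGF_le_mgf.trans ?_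
  rw [ProbabilityTheory.mgf, integral_densityMeasure hg0 hg.measurable,
    ← integral_exp_mul_polar_mul_exp_neg]
  refine integral_mono (integrable_mul_exp_mul_polar hQ hg0 hg hgQ y _)
    (integrable_exp_mul_polar_mul_exp_neg hQ y _) fun x => ?_
  simp only [smul_eq_mul]
  rw [mul_comm]
  gcongr
  exact hgQ x

/-- Both sides are entire and agree at real `z` by completing the square, so the identity theorem
applies. -/
theorem complexMGF_exp_neg (hQ : Q.PosDef) (y : V) (z : ℂ) :
    ProbabilityTheory.complexMGF (QuadraticMap.polar Q y)
      (densityMeasure fun x => Real.exp (-Q x)) z =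
    (∫ x, Real.exp (-Q x) ∂(Measure.addHaar : Measure V) : ℝ) * Complex.exp (z ^ 2 * Q y) := by
  have h1 := differentiable_complexMGF hQ (fun x => (Real.exp_pos _).le)
    (continuous_exp_neg Q) (fun x => le_rfl) y
  have h2 : Differentiable ℂ fun z : ℂ =>
      ((∫ x, Real.exp (-Q x) ∂(Measure.addHaar : Measure V) : ℝ) : ℂ) *
        Complex.exp (z ^ 2 * Q y) := by fun_prop
  refine congrFun (AnalyticOnNhd.eq_of_frequently_eq (z₀ := 0)
    (fun z _ => h1.analyticAt z) (fun z _ => h2.analyticAt z) ?_) z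
  have ht : Tendsto (fun t : ℝ => (t : ℂ)) (𝓝[≠] 0) (𝓝[≠] 0) := by
    refine tendsto_nhdsWithin_of_tendsto_nhds_of_eventually_within _ ?_ ?_
    · exact (Complex.continuous_ofReal.tendsto' 0 0 rfl).mono_left nhdsWithin_le_nhds
    · exact eventually_nhdsWithin_of_forall fun t ht => by simpa using ht
  refine ht.frequently (Eventually.of_forall fun t => ?_).frequently
  rw [ProbabilityTheory.complexMGF_ofReal, ProbabilityTheory.mgf,
    integral_densityMeasure (fun x => (Real.exp_pos _).le) (continuous_exp_neg Q).measurable]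
  simp_rw [smul_eq_mul, mul_comm (Real.exp (-Q _))]
  rw [integral_exp_mul_polar_mul_exp_neg]
  push_cast
  rfl

theorem fourierTransform_exp_neg (hQ : Q.PosDef) (χ : Dual V) :
    fourierTransform (fun x => Real.exp (-Q x)) χ =
      ((∫ x, Real.exp (-Q x) ∂(Measure.addHaar : Measure V)) *
        Real.exp (-Q (polarVector hQ χ)) : ℝ) := by
  conv_lhs => rw [← polarCharacter_polarVector hQ χ]
  rw [fourierTransform_polarCharacter Q (fun x => (Real.exp_pos _).le)
    (continuous_exp_neg Q).measurable, complexMGF_exp_neg hQ]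
  simp

end Gaussian

/-- The Fourier transform of a nonnegative integrable function is positive-definite. -/
theorem sum_fourierTransform_nonneg {g : V → ℝ} (hg0 : ∀ x, 0 ≤ g x)
    (hg : Integrable g (Measure.addHaar : Measure V)) {n : ℕ} (χ : Fin n → Dual V)
    (c : Fin n → ℂ) :
    0 ≤ ∑ i, ∑ j, c i * conj (c j) * fourierTransform g ((χ j)⁻¹ * χ i) := by
  have h : ∑ i, ∑ j, c i * conj (c j) * fourierTransform g ((χ j)⁻¹ * χ i) =
      ((∫ x, ‖∑ i, c i * conj (χ i (Multiplicative.ofAdd x) : ℂ)‖ ^ 2 * g x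
        ∂(Measure.addHaar : Measure V) : ℝ) : ℂ) := by
    -- Expanding the squared modulus produces the double sum under the integral sign.
    have hpt : ∀ x, ((‖∑ i, c i * conj (χ i (Multiplicative.ofAdd x) : ℂ)‖ ^ 2 * g x : ℝ) : ℂ) =
        ∑ i, ∑ j, c i * conj (c j) *
          (conj (((χ j)⁻¹ * χ i) (Multiplicative.ofAdd x) : ℂ) * (g x : ℂ)) := by
      intro x
      have hχ : ∀ i j, (((χ j)⁻¹ * χ i) (Multiplicative.ofAdd x) : ℂ) =
          conj (χ j (Multiplicative.ofAdd x) : ℂ) * (χ i (Multiplicative.ofAdd x) : ℂ) := by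
        intro i j
        rw [← Circle.coe_inv_eq_conj, ← Circle.coe_mul]
        rfl
      rw [Complex.ofReal_mul, Complex.ofReal_pow, ← Complex.mul_conj', map_sum,
        Finset.sum_mul_sum, Finset.sum_mul]
      refine Finset.sum_congr rfl fun i _ => ?_
      rw [Finset.sum_mul]
      refine Finset.sum_congr rfl fun j _ => ?_
      rw [hχ]
      simp only [map_mul, Complex.conj_conj]
      ring
    rw [← integral_complex_ofReal, integral_congr_ae (Eventually.of_forall hpt),
      integral_finsetSum _ fun i _ => integrable_finsetSum _ fun j _ =>
        (integrable_conj_mul hg _).const_mul _]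
    refine Finset.sum_congr rfl fun i _ => ?_
    rw [integral_finsetSum _ fun j _ => (integrable_conj_mul hg _).const_mul _]
    refine Finset.sum_congr rfl fun j _ => ?_
    rw [integral_const_mul, fourierTransform]
  rw [h]
  exact Complex.zero_le_real.2 (integral_nonneg fun x => mul_nonneg (by positivity) (hg0 x))

end GoodFunctions
end

/-! ### Goodness of the Gaussian and Hardy's principle -/

noncomputable section
namespace GoodFunctions

variable {V : Type*} [NormedAddCommGroup V] [InnerProductSpace ℝ V] [FiniteDimensional ℝ V]
  [MeasurableSpace V] [BorelSpace V]

/-- The Gaussian is, up to the factor `C`, the Fourier transform of a nonnegative function, namely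
itself read through the polar form. -/
theorem isPositiveDefinite_exp_neg {Q : QuadraticForm ℝ V} (hQ : Q.PosDef) :
    IsPositiveDefinite (fun x : V => (Real.exp (-Q x) : ℂ)) := by
  intro n x c
  have hC := integral_exp_neg_pos (V := V) hQ
  have h := sum_fourierTransform_nonneg (fun x => (Real.exp_pos (-Q x)).le) (integrable_exp_neg hQ)
    (fun i => polarCharacter Q (.ofAdd (x i))) c
  have h1 : ∀ i j, fourierTransform (fun x => Real.exp (-Q x))
      ((polarCharacter Q (.ofAdd (x j)))⁻¹ * polarCharacter Q (.ofAdd (x i))) =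
      ((∫ x, Real.exp (-Q x) ∂(Measure.addHaar : Measure V) : ℝ) : ℂ) *
        (Real.exp (-Q (x i - x j)) : ℂ) := by
    intro i j
    rw [fourierTransform_exp_neg hQ, polarVector_inv_mul, polarVector_polarCharacter,
      polarVector_polarCharacter, Complex.ofReal_mul]
  simp_rw [h1, mul_left_comm _ (Complex.ofReal _), ← Finset.mul_sum] at h
  have h2 := mul_nonneg (Complex.zero_le_real.2 (inv_pos.2 hC).le) h
  rwa [← mul_assoc, ← Complex.ofReal_mul, inv_mul_cancel₀ hC.ne', Complex.ofReal_one,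
    one_mul] at h2

theorem isGood_exp_neg {Q : QuadraticForm ℝ V} (hQ : Q.PosDef) :
    IsGood (fun x : V => Real.exp (-Q x)) := by
  have hF := funext (fourierTransform_exp_neg hQ)
  refine ⟨⟨fun x => (Real.exp_pos _).le, continuous_exp_neg Q, isPositiveDefinite_exp_neg hQ⟩,
    integrable_exp_neg hQ, ?_, ?_, fun x => Real.exp_pos _, fun χ => ?_,
    fun H hH μ _ _ => integrable_exp_neg_addSubgroup hQ H hH μ, fun K hK μ _ _ => ?_⟩
  · rw [hF]
    exact Complex.continuous_ofReal.comp
      (((continuous_exp_neg Q).comp (continuous_polarVector hQ)).const_mul _)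
  · rw [hF]
    exact ((integrable_exp_neg_polarVector_dual hQ).const_mul _).ofReal
  · rw [fourierTransform_exp_neg hQ, Complex.zero_lt_real]
    exact mul_pos (integral_exp_neg_pos hQ) (Real.exp_pos _)
  · rw [hF]
    exact ((integrable_exp_neg_polarVector hQ K hK μ).const_mul _).ofReal

/-- Hardy's uncertainty principle for nonnegative functions: a function dominated by a Gaussian
whose Fourier transform is dominated by that of the Gaussian is a multiple of it. -/
theorem eq_smul_exp_neg_of_le {Q : QuadraticForm ℝ V} (hQ : Q.PosDef) {g : V → ℝ}
    (hg0 : ∀ x, 0 ≤ g x) (hg : Continuous g) (hgQ : ∀ x, g x ≤ Real.exp (-Q x))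
    (hF : ∀ χ, ‖fourierTransform g χ‖ ≤ ‖fourierTransform (fun x => Real.exp (-Q x)) χ‖) :
    ∃ s : ℝ, 0 ≤ s ∧ g = s • fun x => Real.exp (-Q x) := by
  have hC := integral_exp_neg_pos (V := V) hQ
  set C := ∫ x, Real.exp (-Q x) ∂(Measure.addHaar : Measure V) with hCdef
  -- The ratio of total masses is forced: it compares the two transforms at the trivial character.
  have hs : 0 ≤ (∫ x, g x ∂(Measure.addHaar : Measure V)) / C :=
    div_nonneg (integral_nonneg hg0) hC.le
  have hgi : Integrable g (Measure.addHaar : Measure V) := by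
    refine (integrable_exp_neg hQ).mono' (by fun_prop) (Eventually.of_forall fun x => ?_)
    rw [Real.norm_of_nonneg (hg0 x)]
    exact hgQ x
  refine ⟨_, hs, eq_of_fourierTransform_eq hQ hg0
    (fun x => mul_nonneg hs (Real.exp_pos _).le) hg ((continuous_exp_neg Q).const_smul _)
    hgi ((integrable_exp_neg hQ).smul _) ?_⟩
  rw [fourierTransform_smul]
  funext χ
  rw [Pi.smul_apply, fourierTransform_exp_neg hQ]
  obtain ⟨y, rfl⟩ : ∃ y, polarCharacter Q (.ofAdd y) = χ := ⟨_, polarCharacter_polarVector hQ χ⟩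
  rw [polarVector_polarCharacter, ← hCdef, fourierTransform_polarCharacter Q hg0 hg.measurable]
  set M := ProbabilityTheory.complexMGF (QuadraticMap.polar Q y) (densityMeasure g) with hM
  have hMdiff : Differentiable ℂ M := differentiable_complexMGF hQ hg0 hg hgQ y
  have hQy : 0 ≤ Q y := hQ.nonneg y
  have hnorm : ∀ z : ℂ, ‖Complex.exp (z ^ 2 * Q y)‖ = Real.exp ((z.re ^ 2 - z.im ^ 2) * Q y) := by
    intro z
    rw [Complex.norm_exp]
    simp [pow_two]
  -- The second factor cancels the expected decay of `M` on the imaginary axis. The points `-1` and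
  -- `0` give the transform at `y` and the total mass.
  have hconst := apply_eq_apply_of_norm_le_exp_re_sq
    (F := fun z => M (Complex.I * z) * Complex.exp (z ^ 2 * Q y)) (C := C)
    ((hMdiff.comp (differentiable_id.const_mul _)).mul (by fun_prop)) hQy
    (fun z => ?_) (fun t => ?_) (-1) 0
  · have hM0 : M 0 = (∫ x, g x ∂(Measure.addHaar : Measure V) : ℝ) := by
      rw [hM, ProbabilityTheory.complexMGF, integral_densityMeasure hg0 hg.measurable,
        ← integral_complex_ofReal]
      simp
    have h1 : M (-Complex.I) * Complex.exp (Q y) = (∫ x, g x ∂(Measure.addHaar : Measure V) : ℝ) := by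
      simpa [hM0] using hconst
    have h2 : M (-Complex.I) =
        (∫ x, g x ∂(Measure.addHaar : Measure V) : ℝ) * Complex.exp (-Q y) := by
      rw [← h1, mul_assoc, ← Complex.exp_add, add_neg_cancel, Complex.exp_zero, mul_one]
    rw [h2, smul_eq_mul, ← Complex.ofReal_mul, ← mul_assoc, div_mul_cancel₀ _ hC.ne']
    push_cast
    rfl
  -- The real part of `I * z` is `-z.im`, so the `z.im ^ 2` terms cancel and only `z.re ^ 2`
  -- remains.
  · rw [norm_mul, hnorm]
    calc _ ≤ C * Real.exp ((Complex.I * z).re ^ 2 * Q y) *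
          Real.exp ((z.re ^ 2 - z.im ^ 2) * Q y) := by
          gcongr
          exact norm_complexMGF_le hQ hg0 hg hgQ y _
      _ = _ := by
          rw [mul_assoc, ← Real.exp_add]
          congr 2
          simp
          ring
  -- For real `t`, `M (I * t)` is the transform of `g` at the character of `-t • y`, where `hF`
  -- supplies Gaussian decay.
  · rw [norm_mul, hnorm]
    have h := hF (polarCharacter Q (.ofAdd (-t • y)))
    rw [fourierTransform_exp_neg hQ, polarVector_polarCharacter,
      fourierTransform_polarCharacter Q hg0 hg.measurable, complexMGF_polar_smul,
      ← hCdef, QuadraticMap.map_smul, Complex.norm_real,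
      Real.norm_of_nonneg (mul_nonneg hC.le (Real.exp_pos _).le)] at h
    calc _ ≤ C * Real.exp (-((-t * -t) • Q y)) * Real.exp (t ^ 2 * Q y) := by
          have : Complex.I * (t : ℂ) = -Complex.I * ((-t : ℝ) : ℂ) := by push_cast; ring
          rw [this]
          simp only [Complex.ofReal_re, Complex.ofReal_im]
          rw [show (t ^ 2 - 0 ^ 2) * Q y = t ^ 2 * Q y by ring]
          gcongr
      _ = C := by
          rw [mul_assoc, ← Real.exp_add, smul_eq_mul,
            show -(-t * -t * Q y) + t ^ 2 * Q y = 0 by ring, Real.exp_zero, mul_one]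

/-- Positivity of `h` and of its transform turns the decomposition into the two dominations that
Hardy's principle needs. -/
theorem IsGood.exists_eq_smul_exp_neg {Q : QuadraticForm ℝ V} (hQ : Q.PosDef) {g h : V → ℝ}
    (hg : IsGood g) (hh : IsGood h) (hgh : g + h = fun x => Real.exp (-Q x)) :
    ∃ s : ℝ, 0 ≤ s ∧ g = s • fun x => Real.exp (-Q x) := by
  refine eq_smul_exp_neg_of_le hQ hg.ppd.nonneg hg.ppd.continuous (fun x => ?_) fun χ => ?_
  · rw [← congrFun hgh x, Pi.add_apply]
    linarith [hh.pos x]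
  · rw [← hgh, fourierTransform_add hg.integrable hh.integrable]
    exact CStarAlgebra.norm_le_norm_of_nonneg_of_le (hg.fourierTransform_pos χ).le
      (le_add_of_nonneg_right (hh.fourierTransform_pos χ).le)

end GoodFunctions
end

theorem theorem5p2 (n : ℕ) (Q : QuadraticForm ℝ (EuclideanSpace ℝ (Fin n))) (hQ : Q.PosDef) :
    GoodFunctions.IsGood (fun x : EuclideanSpace ℝ (Fin n) => Real.exp (-Q x)) ∧
    GoodFunctions.GeneratesExtremalRay
      (GoodFunctions.goodCone (EuclideanSpace ℝ (Fin n)))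
      (fun x : EuclideanSpace ℝ (Fin n) => Real.exp (-Q x)) := by
  refine ⟨GoodFunctions.isGood_exp_neg hQ, GoodFunctions.isGood_exp_neg hQ, ?_,
    fun g hg h hh hgh => ⟨GoodFunctions.IsGood.exists_eq_smul_exp_neg hQ hg hh hgh,
      GoodFunctions.IsGood.exists_eq_smul_exp_neg hQ hh hg (by rw [add_comm, hgh])⟩⟩
  exact fun h0 => (Real.exp_pos _).ne' (congrFun h0 0)
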